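/- Let $p$ be a prime, and let $(A,+,\cdot)$ be a nilpotent pre-Lie algebra over $\mathbb F_p$, i.e. an $\mathbb F_p$-vector space with a bilinear product satisfying $(x\cdot y)\cdot z-x\cdot(y\cdot z)=(y\cdot x)\cdot z-y\cdot(x\cdot z)$. Let $k$ be its nilpotency index, i.e. the least positive integer such that every product of $k$ elements of $A$, with any distribution of brackets, is zero, and assume $2^k<p$. For $a,b\in A$ put $L_a(b)=a\cdot b$ and $$e^{L_a}(b)=b+a\cdot b+\tfrac1{2!}\,a\cdot(a\cdot b)+\cdots,\qquad W(a)=a+\tfrac1{2!}\,a\cdot a+\tfrac1{3!}\,a\cdot(a\cdot a)+\cdots,$$ where both sums have $k$ terms (all further products vanish). Then: 1. $W:A\to A$ is bijective. Let $\Omega$ be its inverse and put $a\circ b=a+e^{L_{\Omega(a)}}(b)$ and $a*b=a\circ b-a-b$. 2. $(A,+,\circ)$ (the group of flows of $A$) is an $\mathbb F_p$-brace, i.e. $(A,\circ)$ is a group, $a\circ(b+c)+a=a\circ b+a\circ c$ for all $a,b,c\in A$, and $a*(\alpha b)=\alpha(a*b)$ for all $a,b\in A$, $\alpha\in\mathbb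 F_p$. 3. The brace $(A,+,\circ)$ is strongly nilpotent with the same nilpotency index $k$: setting $A^{[1]}=A$ and $A^{[i+1]}=\sum_{j=1}^{i}A^{[j]}*A^{[i+1-j]}$ for $i\ge1$, where $B*C$ denotes the additive subgroup generated by all $b*c$ with $b\in B$, $c\in C$, the least positive integer $n$ with $A^{[n]}=0$ is $n=k$. 4. For all $a,b\in A$, $$a\cdot b=-\sum_{i=0}^{p-2}\frac1{2^{i}}\bigl((2^{i}a)*b\bigr),$$ where $2^ia$ is the sum of $2^i$ copies of $a$ and $\frac1{2^i}$ is the inverse of $2^i$ in $\mathbb F_p$. -/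

import Mathlib

/-- A non-associative ring `A` has nilpotency index `k`: `k` is the least positive integer such that
all products of `k` elements of `A`, with any distribution of brackets, are zero.
A bracketed word in the elements of `A` is an element of the free magma on `A`. -/
def HasNilpotencyIndex (A : Type*) [NonUnitalNonAssocRing A] (k : ℕ) : Prop :=
  IsLeast {n : ℕ | 0 < n ∧ ∀ w : FreeMagma A, w.length = n → FreeMagma.lift (id : A → A) w = 0} k

/-- `(A, +, ∘)` is a left brace: `(A, ∘)` is a group and `a ∘ (b + c) + a = a ∘ b + a ∘ c`. -/
def IsLeftBrace {A : Type*} [AddCommGroup A] (circ : A → A → A) : Prop :=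
  (∃ G : Group A, ∀ a b : A, G.mul a b = circ a b) ∧
    ∀ a b c : A, circ a (b + c) + a = circ a b + circ a c

/-- The operation `a * b = a ∘ b - a - b` of a brace. -/
def braceStar {A : Type*} [AddCommGroup A] (circ : A → A → A) (a b : A) : A :=
  circ a b - a - b

/-- `(A, +, ∘)` is an `F`-brace: a left brace on an `F`-vector space with `a * (α b) = α (a * b)`. -/
def IsFieldBrace (F : Type*) {A : Type*} [Field F] [AddCommGroup A] [Module F A]
    (circ : A → A → A) : Prop :=
  IsLeftBrace circ ∧
    ∀ (α : F) (a b : A), braceStar circ a (α • b) = α • braceStar circ a b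

/-- The chain `A^{[1]} = A`, `A^{[i+1]} = ∑_{j=1}^{i} A^{[j]} * A^{[i+1-j]}` of additive subgroups,
where `B * C` is the additive subgroup generated by all `b * c` with `b ∈ B`, `c ∈ C`.
The value at index `0` is not used. -/
def strongChain {A : Type*} [AddCommGroup A] (circ : A → A → A) : ℕ → AddSubgroup A
  | 0 => ⊤
  | 1 => ⊤
  | (n + 2) => ⨆ j : Fin (n + 1), AddSubgroup.closure
      (Set.image2 (braceStar circ)
        (strongChain circ (j.val + 1) : Set A) (strongChain circ (n + 1 - j.val) : Set A))
  decreasing_by all_goals omega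

/-- The brace `(A, +, ∘)` is strongly nilpotent of nilpotency index `k`:
`k` is the least positive integer with `A^{[k]} = 0`. -/
def HasStrongNilpotencyIndex {A : Type*} [AddCommGroup A] (circ : A → A → A) (k : ℕ) : Prop :=
  IsLeast {n : ℕ | 0 < n ∧ strongChain circ n = ⊥} k

section Flows

variable (p : ℕ) [Fact p.Prime] {A : Type*} [LeftPreLieRing A] [LeftPreLieAlgebra (ZMod p) A]

/-- `e^{L_a}(b) = b + a·b + (1/2!) a·(a·b) + ⋯`, where the sum stops at place `k`. -/
def flowExp (k : ℕ) (a b : A) : A :=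
  ∑ n ∈ Finset.range k, ((n.factorial : ZMod p))⁻¹ • ((LinearMap.mulLeft (ZMod p) a) ^ n) b

/-- `W(a) = e^{L_a}(1) - 1 = a + (1/2!) a·a + (1/3!) a·(a·a) + ⋯`,
where the sum stops at place `k`. -/
def flowW (k : ℕ) (a : A) : A :=
  ∑ n ∈ Finset.range k,
    (((n + 1).factorial : ZMod p))⁻¹ • ((LinearMap.mulLeft (ZMod p) a) ^ n) a

/-- `Ω`, the inverse function of `W` (meaningful when `W` is bijective). -/
noncomputable def flowOmega (k : ℕ) : A → A :=
  Function.invFun (flowW p k : A → A)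

/-- The operation of the group of flows, `a ∘ b = a + e^{L_{Ω(a)}}(b)`. -/
noncomputable def flowCirc (k : ℕ) (a b : A) : A :=
  a + flowExp p k (flowOmega p k a) b

end Flows

/-! Let V n be the span of all bracketed products of at least n elements: V 1 = A, V k = 0, and
degrees add under products. W is the identity modulo higher degree, so it is bijective and Ω
preserves each V n with n ≥ 1.

Let x act on A × F by ρ(x)(b, t) = (x·b + t x, 0). The pre-Lie identity makes ρ a Lie
representation, and e^{ρ(x)}(b, 1) = (e^{L_x}(b) + W(x), 1), which for x = Ω(a) is b ↦ a ∘ b.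
Associativity of ∘ thus reduces to the closure of the exponentials of ρ(A) under multiplication, a
qualitative Baker–Campbell–Hausdorff theorem (`exists_truncExp_eq_mul`).

Since Ω(s a) is polynomial in s, (s a) * b = s (a·b) + ∑_{j≥2} s^j c_j with c_j ∈ V j. Summing over
the powers s = 2^i with weights 1/s makes degree j a geometric sum of ratio 2^{j-1}. It vanishes for
2 ≤ j < k by Fermat, because 1 < 2^{j-1} < p; degree 1 contributes p - 1 = -1 times a·b
(`mul_eq_neg_sum`).

Finally V i * V j ⊆ V (i+j) gives A^{[n]} ⊆ V n, while the formula puts every product of n elements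
in A^{[n]}; hence the two indices agree. -/

/-! ### Filtered algebras, and W as a perturbation of the identity -/

section MulFiltration

variable {F B : Type*} [Field F] [NonUnitalNonAssocRing B] [Module F B]

/-- A multiplicative decreasing filtration of a non-associative algebra by subspaces. -/
structure IsMulFiltration (V : ℕ → Submodule F B) : Prop where
  anti : Antitone V
  mul_mem : ∀ {i j : ℕ} {a b : B}, a ∈ V i → b ∈ V j → a * b ∈ V (i + j)

variable [SMulCommClass F B B]

variable (F) in
/-- The truncated series `a + (1/2!) a·a + (1/3!) a·(a·a) + ⋯` with `k` terms. -/
def expSubOne (k : ℕ) (a : B) : B :=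
  ∑ n ∈ Finset.range k, (((n + 1).factorial : F))⁻¹ • ((LinearMap.mulLeft F a) ^ n) a

theorem mulLeft_pow_succ_apply (a b : B) (n : ℕ) :
    (LinearMap.mulLeft F a ^ (n + 1)) b = a * (LinearMap.mulLeft F a ^ n) b := by
  rw [pow_succ']; rfl

namespace IsMulFiltration

variable {V : ℕ → Submodule F B} (hV : IsMulFiltration V)
include hV

theorem mulLeft_pow_mem {i j : ℕ} {a b : B} (ha : a ∈ V i) (hb : b ∈ V j) (n : ℕ) :
    (LinearMap.mulLeft F a ^ n) b ∈ V (n * i + j) := by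
  induction n with
  | zero => simpa using hb
  | succ n ih =>
    rw [mulLeft_pow_succ_apply]
    convert hV.mul_mem ha ih using 2
    ring

theorem mulLeft_pow_sub_mem {j : ℕ} {a b : B} (ha : a ∈ V 1) (hb : b ∈ V 1)
    (hab : a - b ∈ V j) (n : ℕ) :
    (LinearMap.mulLeft F a ^ n) a - (LinearMap.mulLeft F b ^ n) b ∈ V (j + n) := by
  induction n with
  | zero => simpa using hab
  | succ n ih =>
    rw [mulLeft_pow_succ_apply, mulLeft_pow_succ_apply]
    have h1 := hV.mul_mem hab (hV.mulLeft_pow_mem ha ha n)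
    have h2 := hV.mul_mem hb ih
    rw [show j + (n * 1 + 1) = j + (n + 1) by ring] at h1
    rw [show 1 + (j + n) = j + (n + 1) by ring] at h2
    convert add_mem h1 h2 using 1
    noncomm_ring

theorem expSubOne_mem {i : ℕ} {a : B} (ha : a ∈ V i) (k : ℕ) : expSubOne F k a ∈ V i :=
  sum_mem fun n _ => (V i).smul_mem _ (hV.anti (by omega) (hV.mulLeft_pow_mem ha ha n))

/-- Beyond the linear term, every difference of terms contains a - b and at least one more factor
from V 1. -/
theorem expSubOne_sub_mem {j k : ℕ} {a b : B} (hk : 0 < k) (ha : a ∈ V 1) (hb : b ∈ V 1)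
    (hab : a - b ∈ V j) : expSubOne F k a - expSubOne F k b - (a - b) ∈ V (j + 1) := by
  obtain ⟨m, rfl⟩ : ∃ m, k = m + 1 := ⟨k - 1, by omega⟩
  have : expSubOne F (m + 1) a - expSubOne F (m + 1) b - (a - b) =
      ∑ n ∈ Finset.range m, (((n + 1 + 1).factorial : F))⁻¹ •
        ((LinearMap.mulLeft F a ^ (n + 1)) a - (LinearMap.mulLeft F b ^ (n + 1)) b) := by
    simp only [expSubOne, Finset.sum_range_succ', smul_sub, Finset.sum_sub_distrib]
    simp
    abel
  rw [this]
  exact sum_mem fun n _ => Submodule.smul_mem _ _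
    (hV.anti (by omega) (hV.mulLeft_pow_sub_mem ha hb hab (n + 1)))

theorem expSubOne_injOn {k : ℕ} (hk : 0 < k) (hVk : V k = ⊥) {a b : B} (ha : a ∈ V 1)
    (hb : b ∈ V 1) (h : expSubOne F k a = expSubOne F k b) : a = b := by
  have key : ∀ j, a - b ∈ V (j + 1) := by
    intro j
    induction j with
    | zero => exact sub_mem ha hb
    | succ j ih =>
      have := hV.expSubOne_sub_mem hk ha hb ih
      rw [h, sub_self, zero_sub] at this
      exact neg_mem_iff.1 this
  have h0 := hV.anti (Nat.le_succ k) (key k)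
  rw [hVk, Submodule.mem_bot] at h0
  exact sub_eq_zero.1 h0

omit hV in
theorem expSubOne_zero (k : ℕ) : expSubOne F k (0 : B) = 0 := by
  simp [expSubOne]

/-- Successive approximation: replacing a by a - (W(a) - c) improves the error by one degree. The
iterates stay in V i, which is why Ω preserves the filtration. -/
theorem exists_expSubOne_eq {i k : ℕ} (hk : 0 < k) (hVk : V k = ⊥) (hi : 1 ≤ i) {c : B}
    (hc : c ∈ V i) : ∃ a ∈ V i, expSubOne F k a = c := by
  have key : ∀ j, ∃ a ∈ V i, expSubOne F k a - c ∈ V (j + 1) := by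
    intro j
    induction j with
    | zero =>
      exact ⟨0, zero_mem _, by rw [expSubOne_zero, zero_sub]; exact neg_mem (hV.anti hi hc)⟩
    | succ j ih =>
      obtain ⟨a, ha, had⟩ := ih
      have ha' : a - (expSubOne F k a - c) ∈ V i :=
        sub_mem ha (sub_mem (hV.expSubOne_mem ha k) hc)
      refine ⟨_, ha', ?_⟩
      have := hV.expSubOne_sub_mem (j := j + 1) hk (hV.anti hi ha') (hV.anti hi ha)
        (by simpa using neg_mem had)
      convert this using 1
      abel
  obtain ⟨a, ha, had⟩ := key k
  have h0 := hV.anti (Nat.le_succ k) had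
  rw [hVk, Submodule.mem_bot] at h0
  exact ⟨a, ha, sub_eq_zero.1 h0⟩

theorem sub_mem_of_expSubOne_eq {i k : ℕ} (hk : 0 < k) {a c : B} (ha : a ∈ V 1) (hai : a ∈ V i)
    (h : expSubOne F k a = c) : c - a ∈ V (i + 1) := by
  have := hV.expSubOne_sub_mem (j := i) (b := 0) hk ha (zero_mem _) (by simpa using hai)
  simpa [expSubOne_zero, h] using this

theorem mulLeft_pow_eq_zero (hV1 : V 1 = ⊤) {k : ℕ} (hVk : V k = ⊥) (x : B) :
    LinearMap.mulLeft F x ^ k = 0 := by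
  refine LinearMap.ext fun b => ?_
  have hx : x ∈ V 1 := hV1 ▸ Submodule.mem_top
  have hb : b ∈ V 1 := hV1 ▸ Submodule.mem_top
  have := hV.anti (show k ≤ k * 1 + 1 by omega) (hV.mulLeft_pow_mem hx hb k)
  rwa [hVk, Submodule.mem_bot] at this

end IsMulFiltration

end MulFiltration

/-! ### Truncated exponentials of nilpotent elements -/

section TruncExp

variable (F : Type*) {R : Type*} [Field F] [Ring R] [Algebra F R]

/-- The exponential series truncated after `k` terms. -/
def truncExp (k : ℕ) (a : R) : R :=
  ∑ n ∈ Finset.range k, ((n.factorial : F))⁻¹ • a ^ n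

theorem truncExp_eq_of_le {k m : ℕ} {a : R} (ha : a ^ k = 0) (hkm : k ≤ m) :
    truncExp F m a = truncExp F k a := by
  refine (Finset.sum_subset (Finset.range_mono hkm) fun n _ hn => ?_).symm
  rw [pow_eq_zero_of_le (by simpa using hn) ha, smul_zero]

theorem truncExp_eq_one_add {k : ℕ} {a : R} (ha : a ^ k = 0) :
    truncExp F k a = 1 + expSubOne F k a := by
  rw [← truncExp_eq_of_le F ha (Nat.le_succ k), truncExp, Finset.sum_range_succ', add_comm]
  simp [expSubOne, LinearMap.pow_mulLeft, pow_succ]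

theorem truncExp_zero {k : ℕ} (hk : 0 < k) : truncExp F k (0 : R) = 1 := by
  rw [truncExp_eq_one_add F (zero_pow hk.ne'), IsMulFiltration.expSubOne_zero, add_zero]

variable {F}

theorem truncExp_map {S : Type*} [Ring S] [Algebra F S] (f : R →ₐ[F] S) (k : ℕ) (a : R) : f (truncExp F k a) = truncExp F k (f a) := by
  simp [truncExp, map_sum, map_smul, map_pow]

theorem inv_factorial_smul_add_pow {a b : R} (hab : Commute a b) {n : ℕ}
    (hn : (n.factorial : F) ≠ 0) :
    ((n.factorial : F))⁻¹ • (a + b) ^ n = ∑ m ∈ Finset.HasAntidiagonal.antidiagonal n,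
      (((m.1.factorial : F))⁻¹ • a ^ m.1) * (((m.2.factorial : F))⁻¹ • b ^ m.2) := by
  rw [hab.add_pow', Finset.smul_sum]
  refine Finset.sum_congr rfl fun m hm => ?_
  have hm' : m.1 + m.2 = n := by simpa using hm
  have h := Nat.add_choose_mul_factorial_mul_factorial m.1 m.2
  rw [hm', ← Nat.choose_symm_of_eq_add hm'.symm] at h
  have h' : ((n.choose m.1 : ℕ) : F) * m.1.factorial * m.2.factorial = n.factorial := by
    rw [← h]
    push_cast
    rfl
  have h1 : (m.1.factorial : F) ≠ 0 := fun h0 => hn (by rw [← h', h0]; ring)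
  have h2 : (m.2.factorial : F) ≠ 0 := fun h0 => hn (by rw [← h', h0]; ring)
  rw [smul_mul_smul_comm, ← Nat.cast_smul_eq_nsmul F, smul_smul]
  congr 1
  have h3 : ((n.choose m.1 : ℕ) : F) ≠ 0 := fun h0 => hn (by rw [← h', h0]; ring)
  rw [← h']
  field_simp

/-- Exponent pairs below k have sum below 2k, and every other pair contributes zero; so truncating
at 2k loses nothing. -/
theorem truncExp_add {k : ℕ} (hfac : ∀ n < 2 * k, (n.factorial : F) ≠ 0) {a b : R}
    (hab : Commute a b) (ha : a ^ k = 0) (hb : b ^ k = 0) :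
    truncExp F (2 * k) (a + b) = truncExp F k a * truncExp F k b := by
  rw [truncExp, Finset.sum_congr rfl fun n hn =>
    inv_factorial_smul_add_pow hab (hfac n (Finset.mem_range.1 hn))]
  simp only [truncExp]
  rw [Finset.sum_mul_sum, ← Finset.sum_product', Finset.sum_sigma']
  symm
  refine Finset.sum_of_injOn (fun m => ⟨m.1 + m.2, m⟩) ?_ ?_ ?_ ?_
  · intro m _ m' _ h
    exact eq_of_heq (Sigma.mk.inj h).2
  · intro m hm
    simp only [Finset.coe_product, Set.mem_prod, Finset.mem_coe, Finset.mem_range] at hm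
    simp
    omega
  · rintro ⟨n, m⟩ hm hm'
    simp only [Finset.mem_sigma, Finset.mem_range, Finset.HasAntidiagonal.mem_antidiagonal] at hm
    obtain ⟨hn, rfl⟩ := hm
    have : k ≤ m.1 ∨ k ≤ m.2 := by
      by_contra! hlt
      exact hm' ⟨m, by simpa using hlt, rfl⟩
    rcases this with h | h
    · simp [pow_eq_zero_of_le h ha]
    · simp [pow_eq_zero_of_le h hb]
  · intro m _
    rfl

theorem truncExp_neg_mul_self {k : ℕ} (hk : 0 < k) (hfac : ∀ n < 2 * k, (n.factorial : F) ≠ 0)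
    {a : R} (ha : a ^ k = 0) : truncExp F k (-a) * truncExp F k a = 1 := by
  rw [← truncExp_add hfac (Commute.refl a).neg_left (by rw [neg_pow, ha, mul_zero]) ha,
    neg_add_cancel, truncExp_zero F (by omega)]

end TruncExp

/-! ### Logarithmic derivative of the exponential -/

section ExpDerivation

variable {F S : Type*} [Field F] [Ring S] [Algebra F S]

/-- The logarithmic derivative of a truncated exponential, for a derivation `D`. -/
theorem truncExp_neg_mul_derivation {k : ℕ} (hk : 0 < k)
    (hfac : ∀ n < 2 * k, (n.factorial : F) ≠ 0) (D : S →ₗ[F] S)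
    (hD : ∀ a b, D (a * b) = D a * b + a * D b) {z : S} (hz : z ^ k = 0) :
    truncExp F k (-z) * D (truncExp F k z) = ∑ n ∈ Finset.range (2 * k - 1),
      (((n + 1).factorial : F))⁻¹ •
        ((LinearMap.mulRight F z - LinearMap.mulLeft F z) ^ n) (D z) := by
  set δ : S →ₗ[F] S := LinearMap.mulRight F z - LinearMap.mulLeft F z with hδ
  set l := Algebra.lmul F S with hl
  -- On End S, a + b sends T to T ∘ l(z) - l(z) ∘ T, so it sends D to l(D z) and l(w) to l(δ w). As
  -- a and b commute, e^{a+b} = e^a e^b; applied to D and evaluated at 1, this is the claim.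
  set a : Module.End F (Module.End F S) := LinearMap.mulLeft F (l (-z)) with ha
  set b : Module.End F (Module.End F S) := LinearMap.mulRight F (l z) with hb
  have hD1 : D 1 = 0 := by simpa using hD 1 1
  have h1 : ∀ n, ((a + b) ^ (n + 1)) D = l ((δ ^ n) (D z)) := by
    intro n
    induction n with
    | zero =>
      ext s
      simp [a, b, l, hD]
    | succ n ih =>
      rw [pow_succ', Module.End.mul_apply, ih, pow_succ' δ, Module.End.mul_apply]
      ext s
      simp [a, b, l, hδ, mul_assoc]
      abel
  have hak : a ^ k = 0 := by
    rw [ha, LinearMap.pow_mulLeft, ← map_pow, neg_pow, hz, mul_zero, map_zero]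
    ext; simp
  have hbk : b ^ k = 0 := by
    rw [hb, LinearMap.pow_mulRight, ← map_pow, hz, map_zero]
    ext; simp
  have h2 := truncExp_add (R := Module.End F (Module.End F S)) (a := a) (b := b) hfac
    (LinearMap.commute_mulLeft_right (R := F) (l (-z)) (l z)) hak hbk
  have h3 : (truncExp F (2 * k) (a + b)) D 1 = (truncExp F k a * truncExp F k b) D 1 := by
    rw [h2]
  have hA : ∀ X, truncExp F k a X = l (truncExp F k (-z)) * X := by
    intro X
    simp [truncExp, ha, LinearMap.pow_mulLeft, Finset.sum_mul]
  have hB : ∀ X, truncExp F k b X = X * l (truncExp F k z) := by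
    intro X
    simp [truncExp, hb, LinearMap.pow_mulRight, Finset.mul_sum]
  rw [Module.End.mul_apply, hB, hA] at h3
  have h4 : truncExp F k (-z) * D (truncExp F k z) =
      (l (truncExp F k (-z)) * (D * l (truncExp F k z))) 1 := by
    simp [l]
  rw [h4, ← h3]
  -- The term of exponent 0 contributes D 1 = 0, which leaves 2k - 1 terms.
  obtain ⟨m, hm⟩ : ∃ m, 2 * k = m + 1 := ⟨2 * k - 1, by omega⟩
  rw [hm, Nat.add_sub_cancel, truncExp, Finset.sum_range_succ']
  change ((∑ n ∈ Finset.range m, (((n + 1).factorial : F))⁻¹ • (a + b) ^ (n + 1) +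
    ((Nat.factorial 0 : F))⁻¹ • (a + b) ^ 0) D) 1 = _
  simp only [LinearMap.add_apply, LinearMap.sum_apply, LinearMap.smul_apply, h1]
  simp [l, hD1]

theorem Submodule.mem_of_add_nilpotent_mem {M : Type*} [AddCommGroup M] [Module F M]
    (P : Submodule F M) {T : Module.End F M} {m : ℕ} (hT : T ^ m = 0) (hP : ∀ w ∈ P, T w ∈ P)
    {w : M} (hw : w + T w ∈ P) : w ∈ P := by
  have hpow : ∀ n, (T ^ n) (w + T w) ∈ P := by
    intro n
    induction n with
    | zero => simpa using hw
    | succ n ih => rw [pow_succ', Module.End.mul_apply]; exact hP _ ih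
  have key : ∀ n ≤ m, (T ^ (m - n)) w ∈ P := by
    intro n
    induction n with
    | zero => intro _; simp [hT]
    | succ n ih =>
      intro hn
      have h1 := hpow (m - (n + 1))
      rw [map_add, ← Module.End.mul_apply, ← pow_succ,
        show m - (n + 1) + 1 = m - n by omega] at h1
      exact (add_mem_cancel_right (ih (by omega))).1 h1
  simpa using key m le_rfl

/-- The series is 1 + δQ with Q a polynomial in δ, so it is unipotent and its inverse preserves P.
This solves the logarithmic derivative equation for D z. -/
theorem Submodule.mem_of_sum_inv_factorial_mem {M : Type*} [AddCommGroup M] [Module F M]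
    (P : Submodule F M) {δ : Module.End F M} {m : ℕ} (hδ : δ ^ m = 0)
    (hP : ∀ w ∈ P, δ w ∈ P) {w : M} (K : ℕ)
    (hw : ∑ n ∈ Finset.range (K + 1), (((n + 1).factorial : F))⁻¹ • (δ ^ n) w ∈ P) : w ∈ P := by
  have hpow : ∀ n, ∀ w ∈ P, (δ ^ n) w ∈ P := by
    intro n
    induction n with
    | zero => simp
    | succ n ih => intro w hw; rw [pow_succ', Module.End.mul_apply]; exact hP _ (ih w hw)
  set Q : Module.End F M := ∑ n ∈ Finset.range K, (((n + 1 + 1).factorial : F))⁻¹ • δ ^ n with hQ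
  have hcomm : Commute δ Q := Commute.sum_right _ _ _ fun n _ =>
    ((Commute.refl δ).pow_right n).smul_right _
  have hTapply : ∀ w, (δ * Q) w =
      ∑ n ∈ Finset.range K, (((n + 1 + 1).factorial : F))⁻¹ • (δ ^ (n + 1)) w := by
    intro w
    simp [hQ, Finset.mul_sum, LinearMap.sum_apply, pow_succ']
  refine P.mem_of_add_nilpotent_mem (T := δ * Q) (m := m) (by rw [hcomm.mul_pow, hδ, zero_mul])
    (fun w hw => ?_) ?_
  · rw [hTapply]
    exact sum_mem fun n _ => P.smul_mem _ (hpow _ _ hw)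
  · rw [hTapply]
    rw [Finset.sum_range_succ'] at hw
    simpa [add_comm] using hw

end ExpDerivation

/-! ### Products of exponentials, by differentiating along a polynomial path -/

section BCH

open Polynomial

variable {F R : Type*} [Field F] [Ring R] [Algebra F R]

namespace IsMulFiltration

theorem pow_succ_mem {N : ℕ → Submodule F R} (hN : IsMulFiltration N) {i : ℕ} {a : R}
    (ha : a ∈ N i) (n : ℕ) : a ^ (n + 1) ∈ N ((n + 1) * i) := by
  induction n with
  | zero => simpa using ha
  | succ n ih =>
    rw [pow_succ]
    convert hN.mul_mem ih ha using 2
    ring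

theorem pow_eq_zero {N : ℕ → Submodule F R} (hN : IsMulFiltration N) {k : ℕ} (hk : 0 < k)
    (hNk : N k = ⊥) {a : R} (ha : a ∈ N 1) : a ^ k = 0 := by
  obtain ⟨m, rfl⟩ : ∃ m, k = m + 1 := ⟨k - 1, by omega⟩
  have := hN.pow_succ_mem ha m
  rwa [mul_one, hNk, Submodule.mem_bot] at this

/-- The filtration of `R[X]` induced by a filtration of `R`, where `X` has degree one. -/
def polynomial (N : ℕ → Submodule F R) (j : ℕ) : Submodule F R[X] where
  carrier := {f | ∀ n, f.coeff n ∈ N (max n j)}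
  add_mem' hf hg n := by rw [coeff_add]; exact add_mem (hf n) (hg n)
  zero_mem' n := by rw [coeff_zero]; exact zero_mem _
  smul_mem' c f hf n := by rw [coeff_smul]; exact (N _).smul_mem c (hf n)

theorem isMulFiltration_polynomial {N : ℕ → Submodule F R} (hN : IsMulFiltration N) :
    IsMulFiltration (polynomial N) where
  anti _ _ hij _ hf n := hN.anti (max_le_max_left n hij) (hf n)
  mul_mem {i j f g} hf hg n := by
    rw [coeff_mul]
    refine sum_mem fun m hm => ?_
    have hm' : m.1 + m.2 = n := by simpa using hm
    exact hN.anti (by omega) (hN.mul_mem (hf m.1) (hg m.2))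

theorem polynomial_eq_bot {N : ℕ → Submodule F R} (hN : IsMulFiltration N) {k : ℕ}
    (hNk : N k = ⊥) : polynomial N k = ⊥ := by
  rw [eq_bot_iff]
  intro f hf
  rw [Submodule.mem_bot]
  ext n
  have := hN.anti (le_max_right n k) (hf n)
  rwa [hNk, Submodule.mem_bot] at this

end IsMulFiltration

open IsMulFiltration

/-- The polynomials whose coefficients up to degree `n` lie in `L`. -/
def Submodule.coeffMemUpTo (L : Submodule F R) (n : ℕ) : Submodule F R[X] where
  carrier := {f | ∀ i ≤ n, f.coeff i ∈ L}
  add_mem' hf hg i hi := by rw [coeff_add]; exact add_mem (hf i hi) (hg i hi)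
  zero_mem' i _ := by rw [coeff_zero]; exact zero_mem _
  smul_mem' c f hf i hi := by rw [coeff_smul]; exact L.smul_mem c (hf i hi)

theorem Submodule.mul_sub_mul_mem_coeffMemUpTo {L : Submodule F R}
    (hL : ∀ a ∈ L, ∀ b ∈ L, a * b - b * a ∈ L) {n : ℕ} {f g : R[X]}
    (hf : f ∈ L.coeffMemUpTo n) (hg : g ∈ L.coeffMemUpTo n) :
    f * g - g * f ∈ L.coeffMemUpTo n := by
  intro i hi
  rw [coeff_sub, coeff_mul, coeff_mul, ← Finset.Nat.sum_antidiagonal_swap,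
    ← Finset.sum_sub_distrib]
  refine sum_mem fun m hm => ?_
  have hm' : m.1 + m.2 = i := by simpa using hm
  exact hL _ (hf _ (by simp; omega)) _ (hg _ (by simp; omega))

/-- Evaluation of polynomials over a noncommutative algebra at a scalar. -/
noncomputable def evalScalarAlgHom (R : Type*) [Ring R] [Algebra F R] (c : F) : R[X] →ₐ[F] R :=
  eval₂AlgHom (AlgHom.id F R) (algebraMap F R c) fun a => (Algebra.commutes c a).symm

theorem evalScalarAlgHom_C (c : F) (a : R) : evalScalarAlgHom R c (C a) = a :=
  eval₂_C _ _

theorem evalScalarAlgHom_C_mul_X (c : F) (a : R) :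
    evalScalarAlgHom R c (C a * X) = a * algebraMap F R c := by
  rw [map_mul, evalScalarAlgHom_C]
  congr 1
  exact eval₂_X _ _

theorem evalScalarAlgHom_zero (f : R[X]) : evalScalarAlgHom R (0 : F) f = f.coeff 0 := by
  change eval₂ (RingHom.id R) (algebraMap F R 0) f = _
  rw [map_zero, coeff_zero_eq_eval_zero]
  rfl

theorem evalScalarAlgHom_one_mem {L : Submodule F R} {f : R[X]} (hf : ∀ n, f.coeff n ∈ L) :
    evalScalarAlgHom R (1 : F) f ∈ L := by
  change eval₂ (RingHom.id R) (algebraMap F R 1) f ∈ L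
  rw [map_one, eval₂_eq_sum_range]
  exact sum_mem fun n _ => by simpa using hf n

theorem exists_polynomial_truncExp_eq {k : ℕ} (hk : 0 < k) {N : ℕ → Submodule F R}
    (hN : IsMulFiltration N) (hNk : N k = ⊥) {x y : R} (hx : x ∈ N 1) (hy : y ∈ N 1) :
    ∃ z ∈ polynomial N 1, truncExp F k z = truncExp F k (C x) * truncExp F k (C y * X) := by
  have hI := hN.isMulFiltration_polynomial
  have hIk := polynomial_eq_bot hN hNk
  have hX : C x ∈ polynomial N 1 := by
    intro n
    rw [coeff_C]
    split_ifs with h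
    · subst h; exact hx
    · exact zero_mem _
  have hY : C y * X ∈ polynomial N 1 := by
    intro n
    rw [coeff_C_mul, coeff_X]
    split_ifs with h
    · subst h; simpa using hy
    · simp
  have hX1 := hI.expSubOne_mem hX k
  have hY1 := hI.expSubOne_mem hY k
  obtain ⟨z, hz, hzE⟩ := hI.exists_expSubOne_eq hk hIk le_rfl
    (add_mem (add_mem hX1 hY1) (hI.anti (by omega) (hI.mul_mem hX1 hY1)))
  refine ⟨z, hz, ?_⟩
  rw [truncExp_eq_one_add F (hI.pow_eq_zero hk hIk hz), hzE,
    truncExp_eq_one_add F (hI.pow_eq_zero hk hIk hX),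
    truncExp_eq_one_add F (hI.pow_eq_zero hk hIk hY)]
  noncomm_ring

/-- The exponentials of the elements of a nilpotent Lie subalgebra are closed under products. -/
theorem exists_truncExp_eq_mul {k : ℕ} (hk : 0 < k)
    (hfac : ∀ n < 2 * k, (n.factorial : F) ≠ 0) {N : ℕ → Submodule F R}
    (hN : IsMulFiltration N) (hNk : N k = ⊥) {L : Submodule F R} (hLN : L ≤ N 1)
    (hL : ∀ a ∈ L, ∀ b ∈ L, a * b - b * a ∈ L) {x y : R} (hx : x ∈ L) (hy : y ∈ L) :
    ∃ z ∈ L, truncExp F k z = truncExp F k x * truncExp F k y := by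
  -- The path z = log(e^x e^{yX}) joins x at X = 0 to the desired element at X = 1, and e^{-z}
  -- D(e^z) = y.
  obtain ⟨z, hz, hzE⟩ := exists_polynomial_truncExp_eq hk hN hNk (hLN hx) (hLN hy)
  have hI := hN.isMulFiltration_polynomial
  have hIk := polynomial_eq_bot hN hNk
  have hzk : z ^ k = 0 := hI.pow_eq_zero hk hIk hz
  have hxk := hN.pow_eq_zero hk hNk (hLN hx)
  have hyk := hN.pow_eq_zero hk hNk (hLN hy)
  have hYk : (C y * X) ^ k = 0 := by
    rw [(commute_X (C y)).symm.mul_pow, ← C_pow, hyk, C_0, zero_mul]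
  let D : R[X] →ₗ[F] R[X] :=
    { toFun := derivative
      map_add' := fun f g => derivative_add
      map_smul' := fun c f => derivative_smul c f }
  have hD : ∀ a b, D (a * b) = D a * b + a * D b := fun a b => derivative_mul
  have hDY : D (truncExp F k (C y * X)) = truncExp F k (C y * X) * C y := by
    have h := truncExp_neg_mul_derivation hk hfac D hD hYk
    have hDy : D (C y * X) = C y := by simp [D]
    -- Since y commutes with yX, only the first term of the series survives.
    have hδ : (LinearMap.mulRight F (C y * X) - LinearMap.mulLeft F (C y * X) :
        Module.End F R[X]) (C y) = 0 := by
      simp [mul_assoc, X_mul_C]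
    obtain ⟨m, hm⟩ : ∃ m, 2 * k - 1 = m + 1 := ⟨2 * k - 2, by omega⟩
    rw [hDy, hm, Finset.sum_range_succ', Finset.sum_eq_zero] at h
    · have h' := truncExp_neg_mul_self (F := F) hk hfac (a := -(C y * X))
        (by rw [neg_pow, hYk, mul_zero])
      rw [neg_neg] at h'
      have h'' := congrArg (truncExp F k (C y * X) * ·) h
      simpa [← mul_assoc, h'] using h''
    · intro n _
      rw [pow_succ, Module.End.mul_apply, hδ, map_zero, smul_zero]
  have hDX : D (truncExp F k (C x)) = 0 := by
    have : truncExp F k (C x) = C (truncExp F k x) :=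
      (truncExp_map (CAlgHom : R →ₐ[F] R[X]) k x).symm
    rw [this]
    exact derivative_C
  have hlog := truncExp_neg_mul_derivation hk hfac D hD hzk
  have hDz : truncExp F k (-z) * D (truncExp F k z) = C y := by
    rw [hzE, hD, hDX, zero_mul, zero_add, hDY, ← mul_assoc (truncExp F k (C x)), ← hzE,
      ← mul_assoc, truncExp_neg_mul_self hk hfac hzk, one_mul]
  rw [hDz, show 2 * k - 1 = 2 * k - 2 + 1 by omega] at hlog
  set δ : Module.End F R[X] := LinearMap.mulRight F z - LinearMap.mulLeft F z with hδ
  obtain ⟨m, hδm⟩ : IsNilpotent δ := by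
    refine (LinearMap.commute_mulLeft_right (R := F) z z).symm.isNilpotent_sub ⟨k, ?_⟩ ⟨k, ?_⟩
    · rw [LinearMap.pow_mulRight, hzk, LinearMap.mulRight_zero_eq_zero]
    · rw [LinearMap.pow_mulLeft, hzk, LinearMap.mulLeft_zero_eq_zero]
  have hz0 : z.coeff 0 = x := by
    refine hN.expSubOne_injOn hk hNk (hz 0) (hLN hx) ?_
    have h := congrArg (evalScalarAlgHom R (0 : F)) hzE
    rw [map_mul, truncExp_map, truncExp_map, truncExp_map, evalScalarAlgHom_C,
      evalScalarAlgHom_C_mul_X, map_zero, mul_zero, truncExp_zero F hk, mul_one,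
      evalScalarAlgHom_zero, truncExp_eq_one_add F hxk,
      truncExp_eq_one_add F (hN.pow_eq_zero hk hNk (hz 0))] at h
    exact add_left_cancel h
  -- The coefficients of z up to degree n control those of D z, hence (n + 1) times the next
  -- coefficient of z. Here n + 1 is invertible if n + 1 < k; otherwise that coefficient is zero by
  -- the filtration.
  have key : ∀ n, z ∈ L.coeffMemUpTo n := by
    intro n
    induction n with
    | zero =>
      intro i hi
      obtain rfl := Nat.le_zero.1 hi
      rwa [hz0]
    | succ n ih =>
      have hDzL : D z ∈ L.coeffMemUpTo n := by
        refine (L.coeffMemUpTo n).mem_of_sum_inv_factorial_mem hδm (fun w hw => ?_) (2 * k - 2) ?_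
        · exact Submodule.mul_sub_mul_mem_coeffMemUpTo hL hw ih
        · rw [← hlog]
          intro i _
          rw [coeff_C]
          split_ifs
          · exact hy
          · exact zero_mem _
      intro i hi
      rcases Nat.lt_or_ge n i with hni | hni
      · obtain rfl : i = n + 1 := by omega
        rcases Nat.lt_or_ge (n + 1) k with hnk | hnk
        · have h1 := hDzL n le_rfl
          have h2 : (D z).coeff n = ((n + 1 : ℕ) : F) • z.coeff (n + 1) := by
            change (derivative z).coeff n = _
            rw [coeff_derivative, Nat.cast_smul_eq_nsmul, nsmul_eq_mul, ← Nat.cast_succ,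
              Nat.cast_comm]
          rw [h2] at h1
          refine (L.smul_mem_iff fun h0 => hfac (n + 1) (by omega) ?_).1 h1
          rw [Nat.factorial_succ, Nat.cast_mul, h0, zero_mul]
        · have h1 := hN.anti (hnk.trans (le_max_left _ 1)) (hz (n + 1))
          rw [hNk, Submodule.mem_bot] at h1
          rw [h1]
          exact zero_mem _
      · exact ih i hni
  refine ⟨evalScalarAlgHom R (1 : F) z, evalScalarAlgHom_one_mem fun n => key n n le_rfl, ?_⟩
  rw [← truncExp_map, hzE, map_mul, truncExp_map, truncExp_map, evalScalarAlgHom_C,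
    evalScalarAlgHom_C_mul_X, map_one, mul_one]

end BCH

/-! ### The affine representation and the group law -/

section AffineRep

variable {F : Type*} [Field F]

/-- The endomorphisms of degree at least `j` of a filtered vector space. -/
def endFiltration {E : Type*} [AddCommGroup E] [Module F E] (M : ℕ → Submodule F E) (j : ℕ) :
    Submodule F (Module.End F E) where
  carrier := {T | ∀ i, ∀ v ∈ M i, T v ∈ M (i + j)}
  add_mem' hS hT i v hv := add_mem (hS i v hv) (hT i v hv)
  zero_mem' _ _ _ := zero_mem _
  smul_mem' c _ hT i v hv := (M _).smul_mem c (hT i v hv)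

theorem isMulFiltration_endFiltration {E : Type*} [AddCommGroup E] [Module F E]
    {M : ℕ → Submodule F E} (hM : Antitone M) : IsMulFiltration (endFiltration M) where
  anti _ _ hij _ hT i v hv := hM (by omega) (hT i v hv)
  mul_mem {i j S T} hS hT a v hv := by
    have := hS _ _ (hT a v hv)
    rwa [add_assoc, add_comm j i] at this

variable {A : Type*} [LeftPreLieRing A] [LeftPreLieAlgebra F A]

variable (F A) in
/-- The representation of the Lie algebra of a pre-Lie algebra by affine vector fields. -/
def affineRep : A →ₗ[F] Module.End F (A × F) :=
  LinearMap.mk₂ F (fun x v => (x * v.1 + v.2 • x, 0))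
    (fun x y v => by ext <;> simp [add_mul]; abel)
    (fun c x v => by ext <;> simp [smul_mul_assoc, smul_add, smul_comm v.2 c x])
    (fun x v w => by ext <;> simp [mul_add, add_smul]; abel)
    (fun c x v => by ext <;> simp [mul_smul_comm, mul_smul])

theorem affineRep_apply (x b : A) (t : F) : affineRep F A x (b, t) = (x * b + t • x, 0) := rfl

/-- On A this is the left symmetry of the associator; the scalar coordinate supplies t (xy - yx). -/
theorem affineRep_mul_sub_mul (x y : A) :
    affineRep F A x * affineRep F A y - affineRep F A y * affineRep F A x =
      affineRep F A (x * y - y * x) := by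
  refine LinearMap.ext fun ⟨b, t⟩ => ?_
  have h := LeftPreLieRing.assoc_symm' x y b
  simp only [associator_apply] at h
  simp only [LinearMap.sub_apply, Module.End.mul_apply, affineRep_apply, Prod.mk_sub_mk, zero_smul,
    mul_add, add_zero, sub_zero, sub_mul, smul_sub, mul_smul_comm, Prod.mk.injEq, and_true]
  have h' : x * (y * b) - y * (x * b) = x * y * b - y * x * b := by
    rw [sub_eq_sub_iff_sub_eq_sub] at h
    rw [← sub_eq_zero] at h ⊢
    rw [← neg_eq_zero, ← h]
    abel
  rw [← h']
  abel

theorem affineRep_pow_succ_apply (x b : A) (t : F) (n : ℕ) :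
    (affineRep F A x ^ (n + 1)) (b, t) =
      ((LinearMap.mulLeft F x ^ (n + 1)) b + t • (LinearMap.mulLeft F x ^ n) x, 0) := by
  induction n with
  | zero => simp [affineRep_apply]
  | succ n ih =>
    rw [pow_succ', Module.End.mul_apply, ih, affineRep_apply, mulLeft_pow_succ_apply _ _ (n + 1),
      mulLeft_pow_succ_apply x x n, mul_add, mul_smul_comm, zero_smul, add_zero]

theorem truncExp_affineRep_apply {k : ℕ} {x : A} (hx : affineRep F A x ^ k = 0)
    (hLx : LinearMap.mulLeft F x ^ k = 0) (b : A) (t : F) :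
    truncExp F k (affineRep F A x) (b, t) =
      (truncExp F k (LinearMap.mulLeft F x) b + t • expSubOne F k x, t) := by
  -- The (n+1)-st power of ρ(x) involves L_x^n x, so k + 1 exponential terms are needed to display
  -- the k terms of W.
  rw [← truncExp_eq_of_le F hx (Nat.le_succ k),
    ← truncExp_eq_of_le (R := Module.End F A) F hLx (Nat.le_succ k)]
  simp only [truncExp, expSubOne, Finset.sum_range_succ' _ k, LinearMap.add_apply,
    LinearMap.sum_apply, LinearMap.smul_apply, affineRep_pow_succ_apply]
  ext
  · simp [Prod.fst_sum, Finset.sum_add_distrib, Finset.smul_sum, smul_comm t]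
    abel
  · simp [Prod.snd_sum]

/-- The filtration of `A × F` induced by a filtration of `A`, with `F` placed in degree zero. -/
def affineFiltration (V : ℕ → Submodule F A) (i : ℕ) : Submodule F (A × F) :=
  (V i).prod (if i = 0 then ⊤ else ⊥)

theorem affineFiltration_antitone {V : ℕ → Submodule F A} (hV : Antitone V) :
    Antitone (affineFiltration V) := by
  intro i j hij
  refine Submodule.prod_mono (hV hij) ?_
  split_ifs <;> first | omega | simp

namespace IsMulFiltration

variable {V : ℕ → Submodule F A} (hV : IsMulFiltration V) (hV1 : V 1 = ⊤)
include hV hV1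

theorem affineRep_mem (x : A) : affineRep F A x ∈ endFiltration (affineFiltration V) 1 := by
  rintro i ⟨b, t⟩ ⟨hb, ht⟩
  have hx : x ∈ V 1 := hV1 ▸ Submodule.mem_top
  refine ⟨?_, by simp [affineRep_apply]⟩
  change x * b + t • x ∈ V (i + 1)
  refine add_mem (add_comm 1 i ▸ hV.mul_mem hx hb) ?_
  by_cases hi : i = 0
  · subst hi
    exact (V _).smul_mem _ hx
  · have ht0 : t = 0 := by simpa [hi] using ht
    rw [ht0, zero_smul]
    exact zero_mem _

theorem endFiltration_affineFiltration_eq_bot {k : ℕ} (hk : 0 < k) (hVk : V k = ⊥) :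
    endFiltration (affineFiltration V) k = ⊥ := by
  rw [eq_bot_iff]
  intro T hT
  have hV0 : V 0 = ⊤ := top_le_iff.1 (hV1 ▸ hV.anti zero_le_one)
  refine (Submodule.mem_bot F).2 (LinearMap.ext fun v => ?_)
  have := hT 0 v (by simp [affineFiltration, hV0])
  simpa [affineFiltration, hVk, hk.ne'] using this

/-- The group law of the flows of a nilpotent pre-Lie algebra. -/
theorem exists_truncExp_mulLeft_eq_mul {k : ℕ} (hk : 0 < k) (hVk : V k = ⊥)
    (hfac : ∀ n < 2 * k, (n.factorial : F) ≠ 0) (x y : A) :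
    ∃ z, expSubOne F k z =
        expSubOne F k x + truncExp F k (LinearMap.mulLeft F x) (expSubOne F k y) ∧
      ∀ b, truncExp F k (LinearMap.mulLeft F z) b =
        truncExp F k (LinearMap.mulLeft F x) (truncExp F k (LinearMap.mulLeft F y) b) := by
  have hN := isMulFiltration_endFiltration (affineFiltration_antitone hV.anti)
  have hNk := endFiltration_affineFiltration_eq_bot hV hV1 hk hVk
  obtain ⟨_, ⟨z, rfl⟩, hz⟩ := exists_truncExp_eq_mul hk hfac hN hNk
    (L := LinearMap.range (affineRep F A))
    (by rintro _ ⟨x, rfl⟩; exact hV.affineRep_mem hV1 x)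
    (by rintro _ ⟨x, rfl⟩ _ ⟨y, rfl⟩; exact ⟨_, (affineRep_mul_sub_mul x y).symm⟩)
    ⟨x, rfl⟩ ⟨y, rfl⟩
  have happ : ∀ (x b : A) (t : F), truncExp F k (affineRep F A x) (b, t) =
      (truncExp F k (LinearMap.mulLeft F x) b + t • expSubOne F k x, t) := fun x =>
    truncExp_affineRep_apply (hN.pow_eq_zero hk hNk (hV.affineRep_mem hV1 x))
      (hV.mulLeft_pow_eq_zero hV1 hVk x)
  refine ⟨z, ?_, fun b => ?_⟩
  -- Evaluation at (0, 1) compares translation parts; evaluation at (b, 0) compares linear parts.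
  · have h := congrArg (fun T => (T (0, 1)).1) hz
    simpa [Module.End.mul_apply, happ, add_comm] using h
  · have h := congrArg (fun T => (T (b, 0)).1) hz
    simpa [Module.End.mul_apply, happ] using h

theorem expSubOne_neg_add {k : ℕ} (hk : 0 < k) (hVk : V k = ⊥)
    (hfac : ∀ n < 2 * k, (n.factorial : F) ≠ 0) (x : A) :
    expSubOne F k (-x) + truncExp F k (LinearMap.mulLeft F (-x)) (expSubOne F k x) = 0 := by
  have hN := isMulFiltration_endFiltration (affineFiltration_antitone hV.anti)
  have hNk := endFiltration_affineFiltration_eq_bot hV hV1 hk hVk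
  have hpow := fun x => hN.pow_eq_zero hk hNk (hV.affineRep_mem hV1 x)
  have happ : ∀ (x b : A) (t : F), truncExp F k (affineRep F A x) (b, t) =
      (truncExp F k (LinearMap.mulLeft F x) b + t • expSubOne F k x, t) := fun x =>
    truncExp_affineRep_apply (hpow x) (hV.mulLeft_pow_eq_zero hV1 hVk x)
  have h := congrArg (fun T => (T (0, 1)).1) (truncExp_neg_mul_self hk hfac (hpow x))
  rw [← map_neg] at h
  simpa only [Module.End.mul_apply, happ, map_zero, zero_add, one_smul, Module.End.one_apply,
    add_comm (expSubOne F k (-x))] using h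

end IsMulFiltration

end AffineRep

/-! ### The filtration by word length -/

section Words

variable (F : Type*) {A : Type*} [Field F] [NonUnitalNonAssocRing A] [Module F A]

variable (A) in
/-- The span of the bracketed products of at least `n` elements. -/
def wordFiltration (n : ℕ) : Submodule F A :=
  Submodule.span F {a | ∃ w : FreeMagma A, n ≤ w.length ∧ FreeMagma.lift (id : A → A) w = a}

theorem FreeMagma.length_mul' {α : Type*} (v w : FreeMagma α) :
    (v * w).length = v.length + w.length := rfl

theorem isMulFiltration_wordFiltration [IsScalarTower F A A] [SMulCommClass F A A] :
    IsMulFiltration (wordFiltration F A) where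
  anti _ _ hij := Submodule.span_mono fun _ ⟨w, hw, h⟩ => ⟨w, hij.trans hw, h⟩
  mul_mem {i j a b} ha hb := by
    refine Submodule.span_induction₂ (p := fun a b _ _ => a * b ∈ wordFiltration F A (i + j))
      ?_ ?_ ?_ ?_ ?_ ?_ ?_ ha hb
    · rintro _ _ ⟨v, hv, rfl⟩ ⟨w, hw, rfl⟩
      exact Submodule.subset_span ⟨v * w, add_le_add hv hw, map_mul _ _ _⟩
    · intro b _; rw [zero_mul]; exact zero_mem _
    · intro a _; rw [mul_zero]; exact zero_mem _
    · intro a a' b _ _ _ h h'; rw [add_mul]; exact add_mem h h'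
    · intro a b b' _ _ _ h h'; rw [mul_add]; exact add_mem h h'
    · intro c a b _ _ h; rw [smul_mul_assoc]; exact Submodule.smul_mem _ c h
    · intro c a b _ _ h; rw [mul_smul_comm]; exact Submodule.smul_mem _ c h

theorem wordFiltration_one : wordFiltration F A 1 = ⊤ :=
  eq_top_iff.2 fun a _ => Submodule.subset_span ⟨FreeMagma.of a, le_rfl, rfl⟩

/-- Replace an innermost product of two letters by its value. Hence vanishing at length exactly k
forces vanishing at all greater lengths. -/
theorem FreeMagma.exists_contraction {α : Type*} [Mul α] (w : FreeMagma α) (hw : 2 ≤ w.length) :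
    ∃ v : FreeMagma α, v.length + 1 = w.length ∧
      FreeMagma.lift (id : α → α) v = FreeMagma.lift (id : α → α) w := by
  induction w with
  | ih1 a => exact absurd hw (by simp [FreeMagma.length])
  | ih2 u v hu hv =>
    rw [FreeMagma.length_mul'] at hw ⊢
    rcases Nat.lt_or_ge u.length 2 with h | h
    · rcases Nat.lt_or_ge v.length 2 with h' | h'
      · have h1 := FreeMagma.length_pos u
        have h2 := FreeMagma.length_pos v
        refine ⟨FreeMagma.of (FreeMagma.lift (id : α → α) (u * v)), ?_, FreeMagma.lift_of _ _⟩
        have : (FreeMagma.of (FreeMagma.lift (id : α → α) (u * v))).length = 1 := rfl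
        omega
      · obtain ⟨v', hl, he⟩ := hv h'
        refine ⟨u * v', ?_, by rw [map_mul, map_mul, he]⟩
        rw [FreeMagma.length_mul']
        omega
    · obtain ⟨u', hl, he⟩ := hu h
      refine ⟨u' * v, ?_, by rw [map_mul, map_mul, he]⟩
      rw [FreeMagma.length_mul']
      omega

theorem wordFiltration_eq_bot {k : ℕ} (hk : 0 < k)
    (h : ∀ w : FreeMagma A, w.length = k → FreeMagma.lift (id : A → A) w = 0) :
    wordFiltration F A k = ⊥ := by
  have key : ∀ n (w : FreeMagma A), w.length = k + n → FreeMagma.lift (id : A → A) w = 0 := by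
    intro n
    induction n with
    | zero => exact h
    | succ n ih =>
      intro w hw
      obtain ⟨v, hl, he⟩ := w.exists_contraction (by omega)
      rw [← he]
      exact ih v (by omega)
  rw [wordFiltration, Submodule.span_eq_bot]
  rintro _ ⟨w, hw, rfl⟩
  exact key (w.length - k) w (by omega)

end Words

/-! ### Polynomial dependence of Ω(s a) on s -/

section PolynomialFunctions

variable {F A : Type*} [Field F] [NonUnitalNonAssocRing A] [Module F A]

/-- The span of the functions `s ↦ s ^ i • c` with `i ≥ j` and `c` in the `i`-th filtration step. -/
def polyFunFiltration (V : ℕ → Submodule F A) (j : ℕ) : Submodule F (F → A) :=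
  Submodule.span F {g | ∃ i, j ≤ i ∧ ∃ c ∈ V i, g = fun s => s ^ i • c}

variable {V : ℕ → Submodule F A}

theorem mem_polyFunFiltration {i j : ℕ} (hij : j ≤ i) {c : A} (hc : c ∈ V i) :
    (fun s => s ^ i • c) ∈ polyFunFiltration V j :=
  Submodule.subset_span ⟨i, hij, c, hc, rfl⟩

theorem polyFunFiltration_eq_bot (hV : Antitone V) {k : ℕ} (hVk : V k = ⊥) :
    polyFunFiltration V k = ⊥ := by
  rw [polyFunFiltration, Submodule.span_eq_bot]
  rintro _ ⟨i, hi, c, hc, rfl⟩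
  have := hV hi hc
  rw [hVk, Submodule.mem_bot] at this
  simp [this]
  rfl

variable [IsScalarTower F A A] [SMulCommClass F A A]

instance Pi.smulCommClass_mul {ι : Type*} : SMulCommClass F (ι → A) (ι → A) :=
  ⟨fun c f g => funext fun i => (mul_smul_comm c (f i) (g i)).symm⟩

theorem isMulFiltration_polyFunFiltration (hV : IsMulFiltration V) :
    IsMulFiltration (polyFunFiltration V) where
  anti _ _ hij := Submodule.span_mono fun _ ⟨i, hi, h⟩ => ⟨i, hij.trans hi, h⟩
  mul_mem {i j a b} ha hb := by
    refine Submodule.span_induction₂ (p := fun a b _ _ => a * b ∈ polyFunFiltration V (i + j))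
      ?_ ?_ ?_ ?_ ?_ ?_ ?_ ha hb
    · rintro _ _ ⟨m, hm, c, hc, rfl⟩ ⟨n, hn, d, hd, rfl⟩
      refine Submodule.subset_span ⟨m + n, add_le_add hm hn, c * d, hV.mul_mem hc hd, ?_⟩
      funext s
      simp [smul_mul_smul_comm, pow_add]
    · intro b _; rw [zero_mul]; exact zero_mem _
    · intro a _; rw [mul_zero]; exact zero_mem _
    · intro a a' b _ _ _ h h'; rw [add_mul]; exact add_mem h h'
    · intro a b b' _ _ _ h h'; rw [mul_add]; exact add_mem h h'
    · intro c a b _ _ h; rw [smul_mul_assoc]; exact Submodule.smul_mem _ c h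
    · intro c a b _ _ h; rw [mul_smul_comm]; exact Submodule.smul_mem _ c h

omit [IsScalarTower F A A] in
theorem mulLeft_pow_pi_apply (q g : F → A) (n : ℕ) (s : F) :
    (LinearMap.mulLeft F q ^ n) g s = (LinearMap.mulLeft F (q s) ^ n) (g s) := by
  induction n with
  | zero => rfl
  | succ n ih => rw [mulLeft_pow_succ_apply, mulLeft_pow_succ_apply, Pi.mul_apply, ih]

omit [IsScalarTower F A A] in
theorem expSubOne_pi_apply (k : ℕ) (q : F → A) (s : F) :
    expSubOne F k q s = expSubOne F k (q s) := by
  simp [expSubOne, Finset.sum_apply, mulLeft_pow_pi_apply]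

/-- The elements `Ω(s a)` and `e^{L_{Ω(s a)}}(b)` are polynomial functions of the scalar `s`. -/
theorem exists_polyFun_expSubOne_eq (hV : IsMulFiltration V) (hV1 : V 1 = ⊤) {k : ℕ} (hk : 0 < k)
    (hVk : V k = ⊥) (a b : A) : ∃ q : F → A, (∀ s, expSubOne F k (q s) = s • a) ∧
      (fun s => truncExp F k (LinearMap.mulLeft F (q s)) b - b - s • (a * b)) ∈
        polyFunFiltration V 2 := by
  have hQ := isMulFiltration_polyFunFiltration hV
  have hQk := polyFunFiltration_eq_bot hV.anti hVk
  have hb : (fun _ : F => b) ∈ polyFunFiltration V 0 := by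
    have hb0 : b ∈ V 0 := hV.anti zero_le_one (hV1 ▸ Submodule.mem_top)
    simpa using mem_polyFunFiltration le_rfl hb0
  have ha : (fun s : F => s • a) ∈ polyFunFiltration V 1 := by
    have ha1 : a ∈ V 1 := hV1 ▸ Submodule.mem_top
    simpa using mem_polyFunFiltration le_rfl ha1
  -- Inverting W inside the filtered algebra of functions F → A makes s ↦ Ω(s a) polynomial at once.
  obtain ⟨q, hq, hqa⟩ := hQ.exists_expSubOne_eq hk hQk le_rfl ha
  refine ⟨q, fun s => by rw [← expSubOne_pi_apply, hqa], ?_⟩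
  have hqa2 := hQ.sub_mem_of_expSubOne_eq hk hq hq hqa
  have hLk := fun s => hV.mulLeft_pow_eq_zero hV1 hVk (q s)
  have hsum : (fun s => truncExp F k (LinearMap.mulLeft F (q s)) b - b - s • (a * b)) =
      ∑ n ∈ Finset.range k, (((n + 1 + 1).factorial : F))⁻¹ •
        (LinearMap.mulLeft F q ^ (n + 1 + 1)) (fun _ => b) -
      ((fun s => s • a) - q) * fun _ => b := by
    funext s
    rw [← truncExp_eq_of_le (R := Module.End F A) F (hLk s) (show k ≤ k + 1 + 1 by omega),
      truncExp, Finset.sum_range_succ', Finset.sum_range_succ']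
    simp only [Pi.sub_apply, Pi.mul_apply, Finset.sum_apply, Pi.smul_apply, mulLeft_pow_pi_apply,
      LinearMap.add_apply, LinearMap.sum_apply, LinearMap.smul_apply, sub_mul, smul_mul_assoc]
    generalize ∑ n ∈ Finset.range k, (((n + 1 + 1).factorial : F))⁻¹ •
      (LinearMap.mulLeft F (q s) ^ (n + 1 + 1)) b = σ
    simp
    abel
  rw [hsum]
  refine sub_mem (sum_mem fun n _ => Submodule.smul_mem _ _ ?_)
    (hQ.anti (by omega) (hQ.mul_mem hqa2 hb))
  exact hQ.anti (by omega) (hQ.mulLeft_pow_mem hq hb (n + 1 + 1))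

end PolynomialFunctions

/-! ### The brace of flows and the recovery of the pre-Lie product -/

section Flows

variable (p : ℕ) [Fact p.Prime]

theorem ZMod.factorial_ne_zero_of_lt {n : ℕ} (hn : n < p) : (n.factorial : ZMod p) ≠ 0 := by
  rw [Ne, ZMod.natCast_eq_zero_iff, (Fact.out : p.Prime).dvd_factorial]
  omega

theorem ZMod.two_pow_ne_zero {k : ℕ} (hp : 2 ^ k < p) (hk : 0 < k) (i : ℕ) :
    (2 : ZMod p) ^ i ≠ 0 := by
  refine pow_ne_zero _ fun h => ?_
  have h2 : p ∣ 2 := (ZMod.natCast_eq_zero_iff 2 p).1 (by exact_mod_cast h)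
  have := Nat.le_of_dvd two_pos h2
  have := Nat.pow_le_pow_right two_pos hk
  omega

theorem ZMod.sum_inv_two_pow_mul {k j : ℕ} (hp : 2 ^ k < p) (hj : 2 ≤ j) (hjk : j < k) :
    ∑ i ∈ Finset.range (p - 1), ((2 : ZMod p) ^ i)⁻¹ * ((2 : ZMod p) ^ i) ^ j = 0 := by
  have h2 := ZMod.two_pow_ne_zero p hp (by omega)
  have hterm : ∀ i, ((2 : ZMod p) ^ i)⁻¹ * ((2 : ZMod p) ^ i) ^ j = (2 ^ (j - 1)) ^ i := by
    intro i
    obtain ⟨m, rfl⟩ : ∃ m, j = m + 1 := ⟨j - 1, by omega⟩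
    rw [pow_succ', inv_mul_cancel_left₀ (h2 i), Nat.add_sub_cancel, ← pow_mul, ← pow_mul, mul_comm]
  have hne : (2 : ZMod p) ^ (j - 1) ≠ 1 := by
    intro h
    have h1 : ((2 ^ (j - 1) : ℕ) : ZMod p) = ((1 : ℕ) : ZMod p) := by
      rw [Nat.cast_pow, Nat.cast_one]
      exact_mod_cast h
    rw [ZMod.natCast_eq_natCast_iff'] at h1
    have hlt : 2 ^ (j - 1) < p := (Nat.pow_le_pow_right two_pos (by omega)).trans_lt hp
    rw [Nat.mod_eq_of_lt hlt, Nat.mod_eq_of_lt (Fact.out : p.Prime).one_lt] at h1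
    have := Nat.pow_le_pow_right two_pos (show 1 ≤ j - 1 by omega)
    omega
  simp_rw [hterm]
  rw [geom_sum_eq hne, ZMod.pow_card_sub_one_eq_one (h2 _), sub_self, zero_div]

theorem sum_inv_two_pow_smul_eq_zero {A : Type*} [AddCommGroup A] [Module (ZMod p) A]
    {V : ℕ → Submodule (ZMod p) A} (hV : Antitone V) {k : ℕ} (hVk : V k = ⊥) (hp : 2 ^ k < p)
    {g : ZMod p → A}
    (hg : g ∈ Submodule.span (ZMod p) {g | ∃ i, 2 ≤ i ∧ ∃ c ∈ V i, g = fun s => s ^ i • c}) :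
    ∑ i ∈ Finset.range (p - 1), ((2 : ZMod p) ^ i)⁻¹ • g (2 ^ i) = 0 := by
  induction hg using Submodule.span_induction with
  | mem g hg =>
    obtain ⟨j, hj, c, hc, rfl⟩ := hg
    rcases Nat.lt_or_ge j k with hjk | hjk
    · simp_rw [smul_smul]
      rw [← Finset.sum_smul, ZMod.sum_inv_two_pow_mul p hp hj hjk, zero_smul]
    · have := hV hjk hc
      rw [hVk, Submodule.mem_bot] at this
      simp [this]
  | zero => simp
  | add f g _ _ hf hg => simp [Finset.sum_add_distrib, hf, hg]
  | smul c g _ hg =>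
    simp_rw [Pi.smul_apply, smul_comm _ c]
    rw [← Finset.smul_sum, hg, smul_zero]

variable {A : Type*} [LeftPreLieRing A] [LeftPreLieAlgebra (ZMod p) A]

theorem flowExp_eq_truncExp (k : ℕ) (a b : A) :
    flowExp p k a b = truncExp (ZMod p) k (LinearMap.mulLeft (ZMod p) a) b := by
  simp [flowExp, truncExp, LinearMap.sum_apply]

theorem braceStar_flowCirc (k : ℕ) (a b : A) :
    braceStar (flowCirc p k) a b = flowExp p k (flowOmega p k a) b - b := by
  simp [braceStar, flowCirc]

namespace IsMulFiltration

variable {p}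
variable {V : ℕ → Submodule (ZMod p) A} (hV : IsMulFiltration V) (hV1 : V 1 = ⊤) {k : ℕ}
  (hk : 0 < k) (hVk : V k = ⊥)
include hV hV1 hk hVk

theorem flowW_injective : Function.Injective (flowW p k : A → A) := fun _ _ h =>
  hV.expSubOne_injOn hk hVk (hV1 ▸ Submodule.mem_top) (hV1 ▸ Submodule.mem_top) h

omit hV1 in
theorem exists_flowW_eq {i : ℕ} (hi : 1 ≤ i) {a : A} (ha : a ∈ V i) :
    ∃ x ∈ V i, flowW p k x = a :=
  hV.exists_expSubOne_eq hk hVk hi ha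

theorem flowW_bijective : Function.Bijective (flowW p k : A → A) :=
  ⟨hV.flowW_injective hV1 hk hVk, fun a =>
    let ⟨x, _, hx⟩ := hV.exists_flowW_eq hk hVk le_rfl
      (show a ∈ V 1 from hV1 ▸ Submodule.mem_top)
    ⟨x, hx⟩⟩

theorem flowOmega_flowW (x : A) : flowOmega p k (flowW p k x) = x :=
  Function.leftInverse_invFun (hV.flowW_injective hV1 hk hVk) x

theorem flowW_flowOmega (a : A) : flowW p k (flowOmega p k a) = a :=
  Function.rightInverse_invFun (hV.flowW_bijective hV1 hk hVk).2 a

theorem flowOmega_mem {i : ℕ} (hi : 1 ≤ i) {a : A} (ha : a ∈ V i) : flowOmega p k a ∈ V i := by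
  obtain ⟨x, hx, rfl⟩ := hV.exists_flowW_eq hk hVk hi ha
  rwa [hV.flowOmega_flowW hV1 hk hVk]

/-- Every term of e^{L_{Ω(a)}}(b) - b has at least one factor Ω(a) ∈ V i. -/
theorem braceStar_flowCirc_mem {i j : ℕ} (hi : 1 ≤ i) {a b : A} (ha : a ∈ V i) (hb : b ∈ V j) :
    braceStar (flowCirc p k) a b ∈ V (i + j) := by
  obtain ⟨m, rfl⟩ : ∃ m, k = m + 1 := ⟨k - 1, by omega⟩
  have hx := hV.flowOmega_mem hV1 hk hVk hi ha
  rw [braceStar_flowCirc, flowExp, Finset.sum_range_succ']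
  simp only [pow_zero, Nat.factorial_zero, Nat.cast_one, inv_one, one_smul, Module.End.one_apply,
    add_sub_cancel_right]
  refine sum_mem fun n _ => Submodule.smul_mem _ _
    (hV.anti ?_ (hV.mulLeft_pow_mem hx hb (n + 1)))
  rw [add_one_mul]
  omega

theorem strongChain_le (n : ℕ) : ∀ x ∈ strongChain (flowCirc p k : A → A → A) n, x ∈ V n := by
  have hV0 : V 0 = ⊤ := top_le_iff.1 (hV1 ▸ hV.anti zero_le_one)
  induction n using Nat.strong_induction_on with
  | _ n ih =>
    match n, ih with
    | 0, _ => intro x _; rw [hV0]; exact Submodule.mem_top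
    | 1, _ => intro x _; rw [hV1]; exact Submodule.mem_top
    | n + 2, ih =>
      rw [strongChain]
      change _ ≤ (V (n + 2)).toAddSubgroup
      refine iSup_le fun j => (AddSubgroup.closure_le _).2 ?_
      rintro _ ⟨a, ha, b, hb, rfl⟩
      have hj := j.2
      have := hV.braceStar_flowCirc_mem hV1 hk hVk (by omega) (ih _ (by omega) a ha)
        (ih _ (by omega) b hb)
      rwa [show j.val + 1 + (n + 1 - j.val) = n + 2 by omega] at this

theorem mul_eq_neg_sum (hp : 2 ^ k < p) (a b : A) : a * b = -∑ i ∈ Finset.range (p - 1),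
    ((2 : ZMod p) ^ i)⁻¹ • braceStar (flowCirc p k : A → A → A) ((2 ^ i : ℕ) • a) b := by
  obtain ⟨q, hq, hqb⟩ := exists_polyFun_expSubOne_eq hV hV1 hk hVk a b
  have h := sum_inv_two_pow_smul_eq_zero p hV.anti hVk hp hqb
  have hstar : ∀ i, braceStar (flowCirc p k : A → A → A) ((2 ^ i : ℕ) • a) b =
      truncExp (ZMod p) k (LinearMap.mulLeft (ZMod p) (q (2 ^ i))) b - b := by
    intro i
    have hs : (2 ^ i : ℕ) • a = flowW p k (q (2 ^ i)) := by
      rw [← Nat.cast_smul_eq_nsmul (ZMod p), Nat.cast_pow, Nat.cast_ofNat]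
      exact (hq _).symm
    rw [braceStar_flowCirc, hs, hV.flowOmega_flowW hV1 hk hVk, flowExp_eq_truncExp]
  have hcancel : ∀ i, ((2 : ZMod p) ^ i)⁻¹ • (2 : ZMod p) ^ i • (a * b) = a * b := fun i =>
    inv_smul_smul₀ (ZMod.two_pow_ne_zero p hp hk i) _
  simp_rw [smul_sub _ (_ - _), hcancel, Finset.sum_sub_distrib, ← hstar] at h
  rw [sub_eq_zero] at h
  rw [h, Finset.sum_const, Finset.card_range, ← Nat.cast_smul_eq_nsmul (ZMod p),
    Nat.cast_sub (Fact.out : p.Prime).one_lt.le]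
  simp

theorem lift_mem_strongChain (hp : 2 ^ k < p) (w : FreeMagma A) :
    FreeMagma.lift (id : A → A) w ∈ strongChain (flowCirc p k : A → A → A) w.length := by
  induction w with
  | ih1 a =>
    change _ ∈ strongChain _ 1
    rw [strongChain]
    exact AddSubgroup.mem_top _
  | ih2 u v hu hv =>
    have h1 := FreeMagma.length_pos u
    have h2 := FreeMagma.length_pos v
    obtain ⟨j, hj⟩ : ∃ j, u.length = j + 1 := ⟨u.length - 1, by omega⟩
    obtain ⟨m, hm⟩ : ∃ m, v.length = m + 1 := ⟨v.length - 1, by omega⟩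
    rw [hj] at hu
    rw [hm] at hv
    rw [map_mul, hV.mul_eq_neg_sum hV1 hk hVk hp, FreeMagma.length_mul', hj, hm,
      show j + 1 + (m + 1) = j + m + 2 by ring, strongChain]
    -- Scalars in F_p act as integer multiples, so additive subgroups are stable under them.
    refine neg_mem (sum_mem fun i _ => ZMod.smul_mem ?_ _)
    refine AddSubgroup.mem_iSup_of_mem (⟨j, by omega⟩ : Fin (j + m + 1))
      (AddSubgroup.subset_closure ⟨_, AddSubgroup.nsmul_mem _ hu _, _, ?_, rfl⟩)
    rw [show j + m + 1 - j = m + 1 by omega]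
    exact hv

variable (hfac : ∀ n < 2 * k, (n.factorial : ZMod p) ≠ 0)
include hfac

/-- The group law gives z = Ω(a ∘ b) with e^{L_z} = e^{L_{Ω(a)}} e^{L_{Ω(b)}}. -/
theorem flowCirc_assoc (a b c : A) : flowCirc p k (flowCirc p k a b) c =
    flowCirc p k a (flowCirc p k b c) := by
  obtain ⟨z, hz, hzL⟩ := hV.exists_truncExp_mulLeft_eq_mul hV1 hk hVk hfac (flowOmega p k a)
    (flowOmega p k b)
  have ha : expSubOne (ZMod p) k (flowOmega p k a) = a := hV.flowW_flowOmega hV1 hk hVk a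
  have hb : expSubOne (ZMod p) k (flowOmega p k b) = b := hV.flowW_flowOmega hV1 hk hVk b
  have hab : flowCirc p k a b = flowW p k z := by
    change _ = expSubOne (ZMod p) k z
    rw [hz, ha, hb, flowCirc, flowExp_eq_truncExp]
  have hΩ : flowOmega p k (flowCirc p k a b) = z := by
    rw [hab, hV.flowOmega_flowW hV1 hk hVk]
  rw [flowCirc, hΩ]
  simp only [flowCirc, flowExp_eq_truncExp, hzL, map_add, add_assoc]

theorem flowCirc_neg (a : A) :
    flowCirc p k (flowW p k (-flowOmega p k a)) a = 0 := by
  have h := hV.expSubOne_neg_add hV1 hk hVk hfac (flowOmega p k a)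
  have ha : expSubOne (ZMod p) k (flowOmega p k a) = a := hV.flowW_flowOmega hV1 hk hVk a
  rw [ha] at h
  rw [flowCirc, hV.flowOmega_flowW hV1 hk hVk, flowExp_eq_truncExp]
  exact h

omit hfac in
theorem zero_flowCirc (a : A) : flowCirc p k 0 a = a := by
  have h0 : flowW p k (0 : A) = 0 := expSubOne_zero k
  have hΩ : flowOmega p k (0 : A) = 0 := by
    conv_lhs => rw [← h0]
    exact hV.flowOmega_flowW hV1 hk hVk 0
  rw [flowCirc, hΩ, flowExp_eq_truncExp, LinearMap.mulLeft_zero_eq_zero,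
    truncExp_zero (R := Module.End (ZMod p) A) _ hk, Module.End.one_apply, zero_add]

theorem isFieldBrace_flowCirc : IsFieldBrace (ZMod p) (flowCirc p k : A → A → A) := by
  refine ⟨⟨?_, fun a b c => ?_⟩, fun α a b => ?_⟩
  · let _ : Mul A := ⟨flowCirc p k⟩
    let _ : One A := ⟨0⟩
    let _ : Inv A := ⟨fun a => flowW p k (-flowOmega p k a)⟩
    exact ⟨Group.ofLeftAxioms (hV.flowCirc_assoc hV1 hk hVk hfac)
      (hV.zero_flowCirc hV1 hk hVk) (hV.flowCirc_neg hV1 hk hVk hfac), fun _ _ => rfl⟩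
  · simp only [flowCirc, flowExp_eq_truncExp, map_add]
    abel
  · rw [braceStar_flowCirc, braceStar_flowCirc, flowExp_eq_truncExp, flowExp_eq_truncExp, map_smul,
      smul_sub]

end IsMulFiltration

end Flows

theorem mainTheorem4 (p : ℕ) [Fact p.Prime] (A : Type*) [LeftPreLieRing A]
    [LeftPreLieAlgebra (ZMod p) A] (k : ℕ) (hk : HasNilpotencyIndex A k) (hp : 2 ^ k < p) :
    Function.Bijective (flowW p k : A → A) ∧
    IsFieldBrace (ZMod p) (flowCirc p k : A → A → A) ∧
    HasStrongNilpotencyIndex (flowCirc p k : A → A → A) k ∧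
    ∀ a b : A, a * b = -∑ i ∈ Finset.range (p - 1),
      ((2 : ZMod p) ^ i)⁻¹ • braceStar (flowCirc p k : A → A → A) ((2 ^ i : ℕ) • a) b := by
  obtain ⟨⟨hk0, hw⟩, hmin⟩ := hk
  have hV := isMulFiltration_wordFiltration (ZMod p) (A := A)
  have hV1 := wordFiltration_one (ZMod p) (A := A)
  have hVk := wordFiltration_eq_bot (ZMod p) hk0 hw
  -- This and 2^k < p make the factorials below 2k invertible, as multiplying exponentials requires.
  have h2k : 2 * k ≤ 2 ^ k := by
    obtain ⟨m, rfl⟩ : ∃ m, k = m + 1 := ⟨k - 1, by omega⟩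
    have := Nat.lt_two_pow_self (n := m)
    rw [pow_succ]
    omega
  have hfac : ∀ n < 2 * k, (n.factorial : ZMod p) ≠ 0 := fun n hn =>
    ZMod.factorial_ne_zero_of_lt p (by omega)
  refine ⟨hV.flowW_bijective hV1 hk0 hVk, hV.isFieldBrace_flowCirc hV1 hk0 hVk hfac,
    ⟨⟨hk0, (AddSubgroup.eq_bot_iff_forall _).2 fun x hx => ?_⟩,
      fun n ⟨hn, hbot⟩ => hmin ⟨hn, fun w hwn => ?_⟩⟩,
    hV.mul_eq_neg_sum hV1 hk0 hVk hp⟩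
  · have := hV.strongChain_le hV1 hk0 hVk k x hx
    rwa [hVk, Submodule.mem_bot] at this
  · have := hV.lift_mem_strongChain hV1 hk0 hVk hp w
    rwa [hwn, hbot, AddSubgroup.mem_bot] at this
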